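/- Two agents $A_0,A_1$ start at the origin of the Euclidean plane and move with speed at most $1$. A target $I$ is hidden on the unit circle $\mathcal D=\{I\in\mathbb R^2:\|I\|_2=1\}$. An algorithm for $\mathrm{WS}_{\mathrm{disk}}^f$ (wireless model) prescribes trajectories of both agents; these may depend on $I$ only after $I$ has been visited by one of the two agents, and until then they coincide with trajectories that do not depend on $I$. Let $T_i(I)\in[0,\infty]$ be the first time at which agent $A_i$ visits $I$. Let $f:\mathbb R^2\to\mathbb R$ be a cost function that, on $[0,\infty)^2$, is non-decreasing in both coordinates and lower semicontinuous (for instance continuous), with $f(1,1)>0$. The search cost of an algorithm is $$\sup_{I\in\mathcal D}\frac{f(T_0(I),T_1(I))}{f(\|I\|_2,\|I\|_2)}\in(0,\infty],$$ where, if a termination time is infinite, $f(T_0,T_1)$ denotes the supremum of $f(x,y)$ over finite $0\le x\le T_0$, $0\le y\le T_1$. Let $n\ge 1$, let $\rho$ be a permutation of the $n$ vertices $\left(\cos\frac{2k\pi}n,\sin\frac{2k\pi}n\right)$, $0\le k<n$, of the regular $n$-gon (write $\rho_i$ also for the $i$-th point in this order), let $b\in\{0,1\}^n$ and $t_0\ge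 0$. Let $\mathrm{REL}_n^f(\rho,b,t_0)$ be the optimal value of the program $$\min\ \max_{1\le i\le n} f(c_i^0,c_i^1)$$ in real variables $c_i^j,\ t_i,\ d_{j,i,j',i'}$ ($j,j'\in\{0,1\}$, $1\le i,i'\le n$), subject to - $t_n\ge t_{n-1}\ge\dots\ge t_1\ge t_0$; - $t_{i+1}-t_i\ge d_{j,i+1,j,i}$ for $1\le i<n$, $j\in\{0,1\}$; - $c_i^j\ge t_i+d_{j,i,b_i,i}$ for $1\le i\le n$, $j\in\{0,1\}$; - $d_{b_i,i,b_{i'},i'}=\|\rho_i-\rho_{i'}\|_2$ for $1\le i,i'\le n$; - $d$ is a (pseudo)metric on the $2n$ indices $(j,i)$: non-negative, symmetric, zero on the diagonal, and satisfying the triangle inequality. Then, for every $n\ge1$ and all $\rho,b$, the minimum $\mathrm{REL}_n^f\left(\rho,b,1+\frac{\pi}{n}\right)$ is attained, and every algorithm for $\mathrm{WS}_{\mathrm{disk}}^f$ has search cost at least $$\frac1{f(1,1)}\ \min_{\rho,\,b}\ \mathrm{REL}_n^f\left(\rho,b,1+\frac{\pi}{n}\right).$$ -/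

import Mathlib

open scoped NNReal ENNReal

/-- The Euclidean plane. -/
abbrev Plane : Type := EuclideanSpace ℝ (Fin 2)

/-- The search domain `disk`: the possible target positions are the points at distance exactly `1`
from the origin. -/
def diskDomain : Set Plane := Metric.sphere 0 1

/-- A solution (algorithm) for searching the domain `D` with two unit-speed agents `0, 1` in the
wireless model. `base i` is the trajectory that agent `i` follows as long as no target is reported,
and `run I i` is the trajectory of agent `i` in the execution with target `I`. All trajectories
start at the origin and have speed at most one. An execution may depend on its target `I` only
after some agent has visited `I`: it agrees with `base` up to and including the first moment at
which an agent is at `I`. -/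
structure SearchAlgorithm (D : Set Plane) where
  base : Fin 2 → ℝ≥0 → Plane
  run : D → Fin 2 → ℝ≥0 → Plane
  base_speed : ∀ i, LipschitzWith 1 (base i)
  run_speed : ∀ I i, LipschitzWith 1 (run I i)
  base_start : ∀ i, base i 0 = 0
  run_start : ∀ I i, run I i 0 = 0
  wireless : ∀ (I : D) (t : ℝ≥0), (∀ s < t, ∀ j, base j s ≠ (I : Plane)) →
    ∀ i, run I i t = base i t

/-- The termination time of agent `i` for target `I`: the first time at which agent `i` visits `I`
(and `∞` if this never happens). -/
noncomputable def SearchAlgorithm.terminationTime {D : Set Plane} (A : SearchAlgorithm D)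
    (i : Fin 2) (I : D) : ℝ≥0∞ :=
  ⨅ (t : ℝ≥0) (_ : A.run I i t = (I : Plane)), (t : ℝ≥0∞)

/-- The value `f (S, T)` of a non-decreasing cost function at termination times that may be
infinite: the supremum of `f` over finite times `x ≤ S`, `y ≤ T`. At finite times it is
`f (S, T)` itself, see `costAt_coe`. -/
noncomputable def costAt (f : ℝ × ℝ → ℝ) (S T : ℝ≥0∞) : EReal :=
  ⨆ (x : ℝ≥0) (y : ℝ≥0) (_ : (x : ℝ≥0∞) ≤ S) (_ : (y : ℝ≥0∞) ≤ T),
    ((f ((x : ℝ), (y : ℝ)) : ℝ) : EReal)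

theorem costAt_coe (f : ℝ × ℝ → ℝ) (hf : MonotoneOn f (Set.Ici 0)) (x y : ℝ≥0) :
    costAt f x y = ((f ((x : ℝ), (y : ℝ)) : ℝ) : EReal) := by
  unfold costAt
  apply le_antisymm
  · refine iSup_le fun x' => iSup_le fun y' => iSup_le fun hx => iSup_le fun hy => ?_
    have hx' : (x' : ℝ) ≤ x := by exact_mod_cast hx
    have hy' : (y' : ℝ) ≤ y := by exact_mod_cast hy
    have h : f ((x' : ℝ), (y' : ℝ)) ≤ f ((x : ℝ), (y : ℝ)) :=
      hf (Set.mem_Ici.2 (Prod.mk_le_mk.2 ⟨x'.2, y'.2⟩))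
        (Set.mem_Ici.2 (Prod.mk_le_mk.2 ⟨x.2, y.2⟩)) (Prod.mk_le_mk.2 ⟨hx', hy'⟩)
    exact_mod_cast h
  · exact le_iSup_of_le x (le_iSup_of_le y (le_iSup_of_le le_rfl (le_iSup_of_le le_rfl le_rfl)))

/-- The search cost of an algorithm: the supremum over all targets `I` of
`f (T₀(I), T₁(I)) / f (‖I‖, ‖I‖)`. -/
noncomputable def SearchAlgorithm.searchCost {D : Set Plane} (A : SearchAlgorithm D)
    (f : ℝ × ℝ → ℝ) : EReal :=
  ⨆ I : D, costAt f (A.terminationTime 0 I) (A.terminationTime 1 I) /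
    ((f (‖(I : Plane)‖, ‖(I : Plane)‖) : ℝ) : EReal)

/-- The vertices of the regular `n`-gon inscribed in the unit circle. -/
noncomputable def gonVertex (n : ℕ) (k : Fin n) : Plane :=
  !₂[Real.cos (2 * (k : ℝ) * Real.pi / n), Real.sin (2 * (k : ℝ) * Real.pi / n)]

/-- The constraints of the relaxation `REL`. Here `c j i` is the time by which agent `j` reaches
the `i`-th visited vertex, `t i` is the time by which that vertex is first visited, and `d` is an
abstract distance on the (not necessarily distinct) points `L (j, i)`. -/
structure RelFeasible (n : ℕ) (ρ : Equiv.Perm (Fin n)) (b : Fin n → Fin 2) (t₀ : ℝ)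
    (c : Fin 2 → Fin n → ℝ) (t : Fin n → ℝ) (d : Fin 2 × Fin n → Fin 2 × Fin n → ℝ) : Prop where
  start : ∀ i, t₀ ≤ t i
  mono : Monotone t
  speed : ∀ i i' : Fin n, (i : ℕ) + 1 = i' → ∀ j, d (j, i') (j, i) ≤ t i' - t i
  arrive : ∀ i j, t i + d (j, i) (b i, i) ≤ c j i
  gon : ∀ i i', d (b i, i) (b i', i') = dist (gonVertex n (ρ i)) (gonVertex n (ρ i'))
  dist_nonneg : ∀ p q, 0 ≤ d p q
  dist_self : ∀ p, d p p = 0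
  dist_symm : ∀ p q, d p q = d q p
  dist_triangle : ∀ p q r, d p r ≤ d p q + d q r

/-- The set of objective values `max_i f (c⁰ᵢ, c¹ᵢ)` of feasible solutions of `REL`. -/
def relValues (f : ℝ × ℝ → ℝ) (n : ℕ) (ρ : Equiv.Perm (Fin n)) (b : Fin n → Fin 2) (t₀ : ℝ) :
    Set ℝ :=
  {v | ∃ c t d, RelFeasible n ρ b t₀ c t d ∧ v = ⨆ i : Fin n, f (c 0 i, c 1 i)}

/-- The optimal value of `REL`. -/
noncomputable def relValue (f : ℝ × ℝ → ℝ) (n : ℕ) (ρ : Equiv.Perm (Fin n)) (b : Fin n → Fin 2)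
    (t₀ : ℝ) : ℝ :=
  sInf (relValues f n ρ b t₀)

/-! Fix `τ < 1 + π / n`. An agent reaches the circle no earlier than time `1`, so before `τ` each
agent sweeps angles of measure at most `τ - 1`. Reduced modulo `2π / n`, the angles of both agents
have measure below `2π / n`, and an uncovered residue gives a rotated `n`-gon with no vertex visited
before `τ` (`exists_rotation_unvisited`). Sort its vertices by first visit. The agents' positions at
these visits form a pseudometric feasible for the relaxation with start `τ`; after a visit, each
agent still needs at least its distance to the target. Hence the relaxed value at `τ` bounds the
cost from below (`exists_relObjective_le`). At `τ = 1 + π / n` the measure inequality is no longer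
strict, so `τ` must tend to this value. The limit rests on lower semicontinuity in the start time,
which follows from compactness: distances can be truncated at `2`, and `t`, `c` replaced by their
earliest values (`isLeast_relValue`, `eventually_lt_relObjective`). -/

/-! ### Arc length swept on the unit circle by a unit-speed curve -/

/-- On short arcs of the unit circle, arc length is almost chord length. -/
theorem exists_abs_sub_le_mul_norm_exp_sub_exp {K : ℝ} (hK : 1 < K) :
    ∃ h > 0, ∀ x y : ℝ, |x - y| ≤ h →
      |x - y| ≤ K * ‖Complex.exp (x * Complex.I) - Complex.exp (y * Complex.I)‖ := by
  have hK0 : 0 < K := by linarith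
  have hpos : 0 < 24 * (1 - 1 / K) := by
    have : 1 / K < 1 := by rwa [div_lt_one hK0]
    linarith
  -- The chord is `2 |sin (u / 2)| ≥ |u| (1 - u² / 24)`; this threshold is where `K (1 - u² / 24) =
  -- 1`.
  refine ⟨√(24 * (1 - 1 / K)), Real.sqrt_pos.2 hpos, fun x y hxy => ?_⟩
  have hnorm : ‖Complex.exp (x * Complex.I) - Complex.exp (y * Complex.I)‖ =
      ‖2 * Real.sin ((x - y) / 2)‖ := by
    rw [← Complex.norm_exp_I_mul_ofReal_sub_one]
    have : Complex.exp (x * Complex.I) - Complex.exp (y * Complex.I) =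
        Complex.exp (y * Complex.I) * (Complex.exp (Complex.I * ((x - y : ℝ) : ℂ)) - 1) := by
      rw [mul_sub, ← Complex.exp_add]
      push_cast
      ring_nf
    rw [this, norm_mul, Complex.norm_exp_ofReal_mul_I, one_mul]
  rw [hnorm]
  generalize x - y = u at hxy ⊢
  rcases eq_or_ne u 0 with rfl | hu
  · simp
  have hu' : 0 < |u| := abs_pos.2 hu
  have hsq : |u| ^ 2 ≤ 24 * (1 - 1 / K) := by
    calc |u| ^ 2 ≤ √(24 * (1 - 1 / K)) ^ 2 := by gcongr
      _ = _ := Real.sq_sqrt hpos.le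
  have hsin : 2 * Real.sin (|u| / 2) ≤ ‖2 * Real.sin (u / 2)‖ := by
    rcases abs_cases u with ⟨h, -⟩ | ⟨h, -⟩
    · rw [h]; exact le_abs_self _
    · rw [h, neg_div, Real.sin_neg, mul_neg]; exact neg_le_abs _
  have hcube := Real.sin_gt_sub_cube (x := |u| / 2) (by positivity)
  have h1 : |u| * (1 - |u| ^ 2 / 24) ≤ 2 * Real.sin (|u| / 2) := by nlinarith
  have h2 : 1 ≤ K * (1 - |u| ^ 2 / 24) := by
    have : K * (1 - (1 - 1 / K)) = 1 := by field_simp; ring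
    nlinarith
  calc |u| = |u| * 1 := (mul_one _).symm
    _ ≤ |u| * (K * (1 - |u| ^ 2 / 24)) := by gcongr
    _ = K * (|u| * (1 - |u| ^ 2 / 24)) := by ring
    _ ≤ K * ‖2 * Real.sin (u / 2)‖ := by gcongr; exact h1.trans hsin

theorem exp_arg_mul_I_of_norm_eq_one {z : ℂ} (hz : ‖z‖ = 1) :
    Complex.exp (Complex.arg z * Complex.I) = z := by
  have := Complex.norm_mul_exp_arg_mul_I z
  rwa [hz, Complex.ofReal_one, one_mul] at this

/-- A curve of speed at most one sweeps on the unit circle a set whose angles, taken modulo `p`,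
have measure at most the time spent. -/
theorem volume_image_toIcoMod_arg_le {p : ℝ} (hp : 0 < p) {γ : ℝ → ℂ} (hγ : LipschitzWith 1 γ)
    {E : Set ℝ} (hE : MeasurableSet E) (hE1 : ∀ s ∈ E, ‖γ s‖ = 1) :
    MeasureTheory.volume ((fun s => toIcoMod hp 0 (γ s).arg) '' E) ≤ MeasureTheory.volume E := by
  have key : ∀ K : ℝ≥0, 1 < K →
      MeasureTheory.volume ((fun s => toIcoMod hp 0 (γ s).arg) '' E) ≤
        K * MeasureTheory.volume E := by
    intro K hK
    obtain ⟨h, hh, hchord⟩ := exists_abs_sub_le_mul_norm_exp_sub_exp (K := K) (by exact_mod_cast hK)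
    -- On each of these countably many pieces the arguments lie within `h` of each other and in the
    -- same period. Thus reduction modulo `p` is a translation there and the angle is `K`-Lipschitz
    -- in time; jumps of `arg` cost nothing.
    let F : ℤ × ℤ → Set ℝ := fun m =>
      E ∩ (fun s => (⌊(γ s).arg / h⌋, ⌊((γ s).arg - 0) / p⌋)) ⁻¹' {m}
    have harg : Measurable fun s => (γ s).arg :=
      Complex.measurable_arg.comp hγ.continuous.measurable
    have hF : ∀ m, MeasurableSet (F m) := fun m =>
      hE.inter ((((harg.div_const h).floor).prodMk (((harg.sub_const 0).div_const p).floor))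
        (measurableSet_singleton m))
    have hdisj : Pairwise (Function.onFun Disjoint F) := fun m m' hm =>
      Set.disjoint_left.2 fun s hs hs' => hm (hs.2.symm.trans hs'.2)
    have hUnion : ⋃ m, F m = E := by
      ext s
      simp [F]
    have hpiece : ∀ m, MeasureTheory.volume ((fun s => toIcoMod hp 0 (γ s).arg) '' F m) ≤
        K * MeasureTheory.volume (F m) := by
      intro m
      have hlip : LipschitzOnWith K (fun s => toIcoMod hp 0 (γ s).arg) (F m) := by
        refine LipschitzOnWith.of_dist_le_mul fun s hs s' hs' => ?_
        obtain ⟨hsE, hsm⟩ := hs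
        obtain ⟨hsE', hsm'⟩ := hs'
        have hsm := hsm.trans hsm'.symm
        obtain ⟨hf1, hf2⟩ := Prod.ext_iff.1 hsm
        dsimp only at hf1 hf2
        have hdist : dist (toIcoMod hp 0 (γ s).arg) (toIcoMod hp 0 (γ s').arg) =
            |(γ s).arg - (γ s').arg| := by
          rw [Real.dist_eq, toIcoMod, toIcoMod, toIcoDiv_eq_floor, toIcoDiv_eq_floor, hf2]
          congr 1
          ring
        have hclose : |(γ s).arg - (γ s').arg| ≤ h := by
          have := (Int.abs_sub_lt_one_of_floor_eq_floor hf1).le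
          rwa [← sub_div, abs_div, abs_of_pos hh, div_le_one hh] at this
        have := hchord _ _ hclose
        rw [exp_arg_mul_I_of_norm_eq_one (hE1 s hsE),
          exp_arg_mul_I_of_norm_eq_one (hE1 s' hsE'), ← dist_eq_norm] at this
        rw [hdist]
        refine this.trans ?_
        gcongr
        simpa using hγ.dist_le_mul s s'
      have := hlip.hausdorffMeasure_image_le (d := 1) zero_le_one
      rwa [MeasureTheory.hausdorffMeasure_real, ENNReal.rpow_one] at this
    calc MeasureTheory.volume ((fun s => toIcoMod hp 0 (γ s).arg) '' E)
        = MeasureTheory.volume (⋃ m, (fun s => toIcoMod hp 0 (γ s).arg) '' F m) := by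
          rw [← Set.image_iUnion, hUnion]
      _ ≤ ∑' m, MeasureTheory.volume ((fun s => toIcoMod hp 0 (γ s).arg) '' F m) :=
          MeasureTheory.measure_iUnion_le _
      _ ≤ ∑' m, K * MeasureTheory.volume (F m) := ENNReal.tsum_le_tsum hpiece
      _ = K * MeasureTheory.volume E := by
          rw [ENNReal.tsum_mul_left, ← MeasureTheory.measure_iUnion hdisj hF, hUnion]
  rcases eq_or_ne (MeasureTheory.volume E) ∞ with htop | htop
  · rw [htop]; exact le_top
  -- Letting `K` decrease to `1` removes the chord-to-arc loss; finiteness of the measure is needed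
  -- here.
  have hlim : Filter.Tendsto (fun K : ℝ≥0 => (K : ℝ≥0∞) * MeasureTheory.volume E)
      (nhdsWithin 1 (Set.Ioi 1)) (nhds ((1 : ℝ≥0) * MeasureTheory.volume E)) :=
    ENNReal.Tendsto.mul_const
      ((ENNReal.tendsto_coe.2 Filter.tendsto_id).mono_left nhdsWithin_le_nhds) (Or.inr htop)
  rw [ENNReal.coe_one, one_mul] at hlim
  exact ge_of_tendsto hlim (by filter_upwards [self_mem_nhdsWithin] with K hK using key K hK)

/-- Two unit-speed curves starting at the origin leave, before time `1 + π / n`, some regular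
`n`-gon inscribed in the unit circle unvisited. -/
theorem exists_rotation_unvisited {n : ℕ} (hn : 1 ≤ n) {γ : Fin 2 → ℝ → ℂ}
    (hγ : ∀ j, LipschitzWith 1 (γ j)) (h0 : ∀ j, γ j 0 = 0) {τ : ℝ} (hτ : τ < 1 + Real.pi / n) :
    ∃ θ : ℝ, ∀ (k : ℕ) (j : Fin 2) (s : ℝ), 0 ≤ s → s < τ →
      γ j s ≠ Complex.exp (((θ + k * (2 * Real.pi / n) : ℝ) : ℂ) * Complex.I) := by
  have hn0 : (0 : ℝ) < n := by exact_mod_cast hn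
  have hp : 0 < 2 * Real.pi / n := by positivity
  let E : Fin 2 → Set ℝ := fun j => Set.Ico 1 τ ∩ {s | ‖γ j s‖ = 1}
  have hE : ∀ j, MeasurableSet (E j) := fun j =>
    measurableSet_Ico.inter ((hγ j).continuous.norm.measurable (measurableSet_singleton 1))
  let B : Fin 2 → Set ℝ := fun j => (fun s => toIcoMod hp 0 (γ j s).arg) '' E j
  have hB : ∀ j, MeasureTheory.volume (B j) ≤ ENNReal.ofReal (τ - 1) := fun j =>
    (volume_image_toIcoMod_arg_le hp (hγ j) (hE j) fun s hs => hs.2).trans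
      ((MeasureTheory.measure_mono Set.inter_subset_left).trans_eq Real.volume_Ico)
  have hlt : MeasureTheory.volume (B 0 ∪ B 1) <
      MeasureTheory.volume (Set.Ico 0 (2 * Real.pi / n)) := by
    refine (MeasureTheory.measure_union_le _ _).trans_lt ((add_le_add (hB 0) (hB 1)).trans_lt ?_)
    rw [Real.volume_Ico, sub_zero, ← two_mul, ← ENNReal.ofReal_ofNat 2,
      ← ENNReal.ofReal_mul (by norm_num), ENNReal.ofReal_lt_ofReal_iff hp, mul_div_assoc]
    linarith
  obtain ⟨θ, hθ, hθB⟩ : ∃ θ ∈ Set.Ico 0 (2 * Real.pi / n), θ ∉ B 0 ∪ B 1 := by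
    by_contra! hcon
    exact absurd (MeasureTheory.measure_mono hcon) hlt.not_ge
  refine ⟨θ, fun k j s hs hsτ hvis => hθB ?_⟩
  have hnorm : ‖γ j s‖ = 1 := by rw [hvis, Complex.norm_exp_ofReal_mul_I]
  have hs1 : 1 ≤ s := by
    have := (hγ j).dist_le_mul s 0
    rw [h0 j, dist_zero_right, hnorm, Real.dist_eq, sub_zero, abs_of_nonneg hs] at this
    simpa using this
  have hmem : θ ∈ B j := by
    refine ⟨s, ⟨⟨hs1, hsτ⟩, hnorm⟩, ?_⟩
    have harg := exp_arg_mul_I_of_norm_eq_one hnorm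
    nth_rw 2 [hvis] at harg
    obtain ⟨m, hm⟩ := Complex.exp_eq_exp_iff_exists_int.1 harg
    -- A full turn is `n` periods, so reduction modulo `2π / n` forgets both the vertex `k` and the
    -- branch of `arg`.
    have hm' : (γ j s).arg = θ + (k + m * n : ℤ) • (2 * Real.pi / n) := by
      have h1 : ((γ j s).arg : ℂ) =
          ((θ + k * (2 * Real.pi / n) + m * (2 * Real.pi) : ℝ) : ℂ) := by
        apply mul_right_cancel₀ Complex.I_ne_zero
        rw [hm]
        push_cast
        ring
      rw [Complex.ofReal_inj.1 h1, zsmul_eq_mul]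
      push_cast
      field_simp
      ring
    dsimp only
    rw [hm', toIcoMod_add_zsmul, toIcoMod_eq_self, zero_add]
    exact hθ
  fin_cases j
  exacts [Or.inl hmem, Or.inr hmem]

/-! ### The relaxation as the minimization of one function of the pseudometric -/

theorem norm_gonVertex (n : ℕ) (k : Fin n) : ‖gonVertex n k‖ = 1 := by
  simp [gonVertex, EuclideanSpace.norm_eq]

theorem dist_gonVertex_le_two (n : ℕ) (k k' : Fin n) :
    dist (gonVertex n k) (gonVertex n k') ≤ 2 := by
  rw [dist_eq_norm]
  refine (norm_sub_le _ _).trans ?_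
  rw [norm_gonVertex, norm_gonVertex]
  norm_num

/-- The pseudometrics of the relaxation that are bounded by `2`. -/
structure IsRelMetric {n : ℕ} (ρ : Equiv.Perm (Fin n)) (b : Fin n → Fin 2)
    (d : Fin 2 × Fin n → Fin 2 × Fin n → ℝ) : Prop where
  gon : ∀ i i', d (b i, i) (b i', i') = dist (gonVertex n (ρ i)) (gonVertex n (ρ i'))
  dist_nonneg : ∀ p q, 0 ≤ d p q
  dist_self : ∀ p, d p p = 0
  dist_symm : ∀ p q, d p q = d q p
  dist_triangle : ∀ p q r, d p r ≤ d p q + d q r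
  le_two : ∀ p q, d p q ≤ 2

theorem isCompact_isRelMetric {n : ℕ} (ρ : Equiv.Perm (Fin n)) (b : Fin n → Fin 2) :
    IsCompact {d | IsRelMetric ρ b d} := by
  have hbox : IsCompact (Set.univ.pi fun _ : Fin 2 × Fin n =>
      Set.univ.pi fun _ : Fin 2 × Fin n => Set.Icc (0 : ℝ) 2) :=
    isCompact_univ_pi fun _ => isCompact_univ_pi fun _ => isCompact_Icc
  refine hbox.of_isClosed_subset ?_ fun d hd => ?_
  · have : {d | IsRelMetric ρ b d} =
        {d | (∀ i i', d (b i, i) (b i', i') = dist (gonVertex n (ρ i)) (gonVertex n (ρ i'))) ∧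
          (∀ p q, 0 ≤ d p q) ∧ (∀ p, d p p = 0) ∧ (∀ p q, d p q = d q p) ∧
          (∀ p q r, d p r ≤ d p q + d q r) ∧ ∀ p q, d p q ≤ 2} :=
      Set.ext fun d => ⟨fun h => ⟨h.1, h.2, h.3, h.4, h.5, h.6⟩,
        fun ⟨h1, h2, h3, h4, h5, h6⟩ => ⟨h1, h2, h3, h4, h5, h6⟩⟩
    rw [this]
    simp only [Set.ofPred_and, Set.ofPred_forall]
    refine .inter (isClosed_iInter fun _ => isClosed_iInter fun _ => ?_) <|
      .inter (isClosed_iInter fun _ => isClosed_iInter fun _ => ?_) <|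
      .inter (isClosed_iInter fun _ => ?_) <|
      .inter (isClosed_iInter fun _ => isClosed_iInter fun _ => ?_) <|
      .inter (isClosed_iInter fun _ => isClosed_iInter fun _ => isClosed_iInter fun _ => ?_) <|
      isClosed_iInter fun _ => isClosed_iInter fun _ => ?_
    all_goals first
      | exact isClosed_eq (by fun_prop) (by fun_prop)
      | exact isClosed_le (by fun_prop) (by fun_prop)
  · simp only [Set.mem_pi, Set.mem_univ, true_imp_iff, Set.mem_Icc]
    exact fun p q => ⟨hd.dist_nonneg p q, hd.le_two p q⟩

theorem exists_isRelMetric {n : ℕ} (ρ : Equiv.Perm (Fin n)) (b : Fin n → Fin 2) :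
    ∃ d, IsRelMetric ρ b d :=
  ⟨fun p q => dist (gonVertex n (ρ p.2)) (gonVertex n (ρ q.2)), fun _ _ => rfl,
    fun _ _ => dist_nonneg, fun _ => dist_self _, fun _ _ => dist_comm _ _,
    fun _ _ _ => dist_triangle _ _ _, fun _ _ => dist_gonVertex_le_two _ _ _⟩

/-- Chords of the unit circle are at most `2`, so truncation respects the prescribed distances. It
confines the distances to a compact set while only weakening the lower bounds on `t` and `c`. -/
theorem RelFeasible.isRelMetric_min {n : ℕ} {ρ : Equiv.Perm (Fin n)} {b : Fin n → Fin 2} {t₀ : ℝ}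
    {c : Fin 2 → Fin n → ℝ} {t : Fin n → ℝ} {d : Fin 2 × Fin n → Fin 2 × Fin n → ℝ}
    (h : RelFeasible n ρ b t₀ c t d) : IsRelMetric ρ b fun p q => min (d p q) 2 where
  gon i i' := by rw [h.gon, min_eq_left (dist_gonVertex_le_two _ _ _)]
  dist_nonneg p q := le_min (h.dist_nonneg p q) zero_le_two
  dist_self p := by rw [h.dist_self, min_eq_left zero_le_two]
  dist_symm p q := by rw [h.dist_symm]
  dist_triangle p q r := by
    have h1 := h.dist_nonneg p q
    have h2 := h.dist_nonneg q r
    have h3 := h.dist_triangle p q r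
    grind
  le_two p q := min_le_right _ _

/-- The largest displacement of an agent between the `m`-th and the next visit. -/
noncomputable def relStep {n : ℕ} (d : Fin 2 × Fin n → Fin 2 × Fin n → ℝ) (m : ℕ) : ℝ :=
  if h : m + 1 < n then
    max (d (0, ⟨m + 1, h⟩) (0, ⟨m, m.lt_succ_self.trans h⟩))
      (d (1, ⟨m + 1, h⟩) (1, ⟨m, m.lt_succ_self.trans h⟩))
  else 0

/-- The earliest visit times compatible with the distances `d`. -/
noncomputable def relTime {n : ℕ} (d : Fin 2 × Fin n → Fin 2 × Fin n → ℝ) (t₀ : ℝ) (i : Fin n) :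
    ℝ :=
  t₀ + ∑ m ∈ Finset.range i, relStep d m

/-- The earliest arrival times compatible with the distances `d`. -/
noncomputable def relArrival {n : ℕ} (b : Fin n → Fin 2)
    (d : Fin 2 × Fin n → Fin 2 × Fin n → ℝ) (t₀ : ℝ) (j : Fin 2) (i : Fin n) : ℝ :=
  relTime d t₀ i + d (j, i) (b i, i)

/-- The objective value at the earliest arrival times, with `f` extended from the quadrant. -/
noncomputable def relObjective (f : ℝ × ℝ → ℝ) {n : ℕ} (b : Fin n → Fin 2)
    (d : Fin 2 × Fin n → Fin 2 × Fin n → ℝ) (t₀ : ℝ) : ℝ :=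
  ⨆ i, f ((relArrival b d t₀ 0 i, relArrival b d t₀ 1 i) ⊔ 0)

section

variable {n : ℕ} {ρ : Equiv.Perm (Fin n)} {b : Fin n → Fin 2} {t₀ : ℝ}
  {d : Fin 2 × Fin n → Fin 2 × Fin n → ℝ}

theorem relStep_nonneg (hd : ∀ p q, 0 ≤ d p q) (m : ℕ) : 0 ≤ relStep d m := by
  unfold relStep
  split
  · exact le_max_of_le_left (hd _ _)
  · exact le_rfl

theorem continuous_relStep (m : ℕ) :
    Continuous fun d : Fin 2 × Fin n → Fin 2 × Fin n → ℝ => relStep d m := by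
  unfold relStep
  split
  · fun_prop
  · fun_prop

theorem continuous_relArrival (b : Fin n → Fin 2) (j : Fin 2) (i : Fin n) :
    Continuous fun x : ℝ × (Fin 2 × Fin n → Fin 2 × Fin n → ℝ) => relArrival b x.2 x.1 j i := by
  unfold relArrival relTime
  have := fun m => (continuous_relStep (n := n) m)
  fun_prop

theorem RelFeasible.relTime_min_le {c : Fin 2 → Fin n → ℝ} {t : Fin n → ℝ}
    (h : RelFeasible n ρ b t₀ c t d) (i : Fin n) :
    relTime (fun p q => min (d p q) 2) t₀ i ≤ t i := by
  obtain ⟨i, hi⟩ := i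
  induction i with
  | zero => simpa [relTime] using h.start _
  | succ m ih =>
    have hm := ih (m.lt_succ_self.trans hi)
    have hstep : relStep (fun p q => min (d p q) 2) m ≤
        t ⟨m + 1, hi⟩ - t ⟨m, m.lt_succ_self.trans hi⟩ := by
      rw [relStep, dif_pos hi]
      exact max_le ((min_le_left _ _).trans (h.speed _ _ rfl 0))
        ((min_le_left _ _).trans (h.speed _ _ rfl 1))
    simp only [relTime, Finset.sum_range_succ] at hm ⊢
    linarith

theorem RelFeasible.relArrival_min_le {c : Fin 2 → Fin n → ℝ} {t : Fin n → ℝ}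
    (h : RelFeasible n ρ b t₀ c t d) (j : Fin 2) (i : Fin n) :
    relArrival b (fun p q => min (d p q) 2) t₀ j i ≤ c j i :=
  (add_le_add (h.relTime_min_le i) (min_le_left _ _)).trans (h.arrive i j)

theorem le_relTime (hd : ∀ p q, 0 ≤ d p q) (i : Fin n) : t₀ ≤ relTime d t₀ i :=
  le_add_of_nonneg_right (Finset.sum_nonneg fun m _ => relStep_nonneg hd m)

theorem IsRelMetric.relFeasible (hd : IsRelMetric ρ b d) (t₀ : ℝ) :
    RelFeasible n ρ b t₀ (relArrival b d t₀) (relTime d t₀) d where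
  start := le_relTime hd.dist_nonneg
  mono i i' hi := by
    unfold relTime
    gcongr with m
    · exact fun m _ _ => relStep_nonneg hd.dist_nonneg m
    · exact hi
  speed i i' hi j := by
    obtain ⟨i, hin⟩ := i
    obtain ⟨i', hin'⟩ := i'
    dsimp only at hi
    subst hi
    rw [relTime, relTime, Finset.sum_range_succ, relStep, dif_pos hin']
    fin_cases j
    · simp
    · simp
  arrive i j := le_rfl
  gon := hd.gon
  dist_nonneg := hd.dist_nonneg
  dist_self := hd.dist_self
  dist_symm := hd.dist_symm
  dist_triangle := hd.dist_triangle

variable {f : ℝ × ℝ → ℝ}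

/-- Taking the supremum with `0` keeps the argument of `f` in the quadrant for every `(t₀, d)`, so
semicontinuity there suffices. -/
theorem lowerSemicontinuous_relObjective (hlsc : LowerSemicontinuousOn f (Set.Ici 0))
    (b : Fin n → Fin 2) :
    LowerSemicontinuous fun x : ℝ × (Fin 2 × Fin n → Fin 2 × Fin n → ℝ) =>
      relObjective f b x.2 x.1 := by
  refine lowerSemicontinuous_ciSup (fun x => (Set.finite_range _).bddAbove) fun i => ?_
  have hcont : Continuous fun x : ℝ × (Fin 2 × Fin n → Fin 2 × Fin n → ℝ) =>
      (relArrival b x.2 x.1 0 i, relArrival b x.2 x.1 1 i) ⊔ 0 :=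
    ((continuous_relArrival b 0 i).sup continuous_const).prodMk
      ((continuous_relArrival b 1 i).sup continuous_const)
  exact lowerSemicontinuousOn_univ_iff.1
    (hlsc.comp hcont.continuousOn fun x _ => Set.mem_Ici.2 le_sup_right)

theorem RelFeasible.relObjective_min_le (hmono : MonotoneOn f (Set.Ici 0)) (ht₀ : 0 ≤ t₀)
    {c : Fin 2 → Fin n → ℝ} {t : Fin n → ℝ} (h : RelFeasible n ρ b t₀ c t d) :
    relObjective f b (fun p q => min (d p q) 2) t₀ ≤ ⨆ i, f (c 0 i, c 1 i) := by
  refine ciSup_mono (Set.finite_range _).bddAbove fun i => ?_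
  have hc : ∀ j, 0 ≤ c j i := fun j =>
    (add_nonneg (ht₀.trans (h.start i)) (h.dist_nonneg _ _)).trans (h.arrive i j)
  have hc' : (0 : ℝ × ℝ) ≤ (c 0 i, c 1 i) := ⟨hc 0, hc 1⟩
  exact hmono (Set.mem_Ici.2 le_sup_right) hc'
    (sup_le ⟨h.relArrival_min_le 0 i, h.relArrival_min_le 1 i⟩ hc')

theorem IsRelMetric.relObjective_mem_relValues (ht₀ : 0 ≤ t₀) (hd : IsRelMetric ρ b d) :
    relObjective f b d t₀ ∈ relValues f n ρ b t₀ := by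
  refine ⟨_, _, d, hd.relFeasible t₀, ?_⟩
  unfold relObjective
  congr 1
  ext i
  have h : ∀ j, 0 ≤ relArrival b d t₀ j i := fun j =>
    add_nonneg (ht₀.trans (le_relTime hd.dist_nonneg i)) (hd.dist_nonneg _ _)
  rw [sup_eq_left.2]
  exact ⟨h 0, h 1⟩

theorem isLeast_relValue (hmono : MonotoneOn f (Set.Ici 0))
    (hlsc : LowerSemicontinuousOn f (Set.Ici 0)) (ρ : Equiv.Perm (Fin n))
    (b : Fin n → Fin 2) (ht₀ : 0 ≤ t₀) :
    IsLeast (relValues f n ρ b t₀) (relValue f n ρ b t₀) := by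
  have hlsc' : LowerSemicontinuous fun d => relObjective f b d t₀ :=
    (lowerSemicontinuous_relObjective hlsc b).comp (Continuous.prodMk_right t₀)
  obtain ⟨d, hd, hmin⟩ := (hlsc'.lowerSemicontinuousOn {d | IsRelMetric ρ b d}).exists_isMinOn
    (exists_isRelMetric ρ b) (isCompact_isRelMetric ρ b)
  have hleast : IsLeast (relValues f n ρ b t₀) (relObjective f b d t₀) := by
    refine ⟨IsRelMetric.relObjective_mem_relValues ht₀ hd, ?_⟩
    rintro _ ⟨c, t, d', h, rfl⟩
    exact (hmin h.isRelMetric_min).trans (h.relObjective_min_le hmono ht₀)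
  rw [relValue, hleast.csInf_eq]
  exact hleast

/-- The optimal value of the relaxation is lower semicontinuous in the starting time. -/
theorem eventually_lt_relObjective (hmono : MonotoneOn f (Set.Ici 0))
    (hlsc : LowerSemicontinuousOn f (Set.Ici 0)) (ht₀ : 0 ≤ t₀) {w : ℝ}
    (hw : w < relValue f n ρ b t₀) :
    ∀ᶠ s in nhds t₀, ∀ d, IsRelMetric ρ b d → w < relObjective f b d s := by
  -- Joint semicontinuity gives a neighbourhood of each `(t₀, d)`; compactness in `d` makes the one
  -- in `t₀` uniform.
  refine (isCompact_isRelMetric ρ b).eventually_forall_of_forall_eventually fun d hd => ?_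
  exact lowerSemicontinuous_relObjective hlsc b (t₀, d) w
    (hw.trans_le ((isLeast_relValue hmono hlsc ρ b ht₀).2
      (IsRelMetric.relObjective_mem_relValues ht₀ hd)))

end

/-! ### Search algorithms give feasible solutions of the relaxation -/

theorem le_costAt (f : ℝ × ℝ → ℝ) {S T : ℝ≥0∞} {x y : ℝ≥0} (hx : (x : ℝ≥0∞) ≤ S)
    (hy : (y : ℝ≥0∞) ≤ T) : ((f (x, y) : ℝ) : EReal) ≤ costAt f S T :=
  le_iSup_of_le x (le_iSup_of_le y (le_iSup_of_le hx (le_iSup_of_le hy le_rfl)))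

theorem gonVertex_eq_repr_exp (n : ℕ) (k : Fin n) :
    gonVertex n k = Complex.orthonormalBasisOneI.repr
      (Complex.exp (((k : ℕ) * (2 * Real.pi / n) : ℝ) * Complex.I)) := by
  ext i
  rw [gonVertex, Complex.orthonormalBasisOneI_repr_apply, Complex.exp_ofReal_mul_I_re,
    Complex.exp_ofReal_mul_I_im, mul_div_assoc', mul_left_comm, ← mul_assoc]

namespace SearchAlgorithm

/-- Before time `1 + π / n` some regular `n`-gon inscribed in the unit circle is unvisited. -/
theorem exists_gon_unvisited {D : Set Plane} (A : SearchAlgorithm D) {n : ℕ} (hn : 1 ≤ n) {τ : ℝ}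
    (hτ : τ < 1 + Real.pi / n) :
    ∃ P : Fin n → Plane, (∀ k, ‖P k‖ = 1) ∧
      (∀ k k', dist (P k) (P k') = dist (gonVertex n k) (gonVertex n k')) ∧
      ∀ k j (t : ℝ≥0), A.base j t = P k → τ ≤ t := by
  let e := Complex.orthonormalBasisOneI.repr
  have hlip : ∀ j, LipschitzWith 1 fun x : ℝ => e.symm (A.base j x.toNNReal) := fun j => by
    have := e.symm.lipschitz.comp ((A.base_speed j).comp Real.lipschitzWith_toNNReal)
    rwa [mul_one, mul_one] at this
  obtain ⟨θ, hθ⟩ := exists_rotation_unvisited hn hlip (fun j => by simp [A.base_start]) hτ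
  refine ⟨fun k => e (Complex.exp (((θ + (k : ℕ) * (2 * Real.pi / n) : ℝ) : ℂ) * Complex.I)),
    fun k => ?_, fun k k' => ?_, fun k j t ht => ?_⟩
  · rw [e.norm_map, Complex.norm_exp_ofReal_mul_I]
  · rw [gonVertex_eq_repr_exp, gonVertex_eq_repr_exp, e.dist_map, LinearIsometryEquiv.dist_map,
      dist_eq_norm, dist_eq_norm]
    simp only [Complex.ofReal_add, add_mul, Complex.exp_add]
    rw [← mul_sub, norm_mul, Complex.norm_exp_ofReal_mul_I, one_mul]
  · by_contra! hlt
    refine hθ k j t t.2 hlt ?_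
    rw [Real.toNNReal_coe, ht, e.symm_apply_apply]

/-- The visiting times of both agents form a closed set, so their infimum is attained. -/
theorem exists_first_visit {D : Set Plane} (A : SearchAlgorithm D) {I : Plane}
    (h : ∃ j t, A.base j t = I) :
    ∃ j t, A.base j t = I ∧ ∀ s < t, ∀ i, A.base i s ≠ I := by
  have hclosed : IsClosed {t | ∃ j, A.base j t = I} := by
    simp only [Set.ofPred_exists]
    exact isClosed_iUnion_of_finite fun j =>
      isClosed_eq (A.base_speed j).continuous continuous_const
  obtain ⟨j, t, ht⟩ := h
  obtain ⟨i, hi⟩ := hclosed.csInf_mem ⟨t, j, ht⟩ (OrderBot.bddBelow _)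
  exact ⟨i, _, hi, fun s hs i' hi' => notMem_of_lt_csInf hs (OrderBot.bddBelow _) ⟨i', hi'⟩⟩

theorem terminationTime_eq_top {D : Set Plane} (A : SearchAlgorithm D) {I : D}
    (h : ∀ j t, A.base j t ≠ I) (i : Fin 2) : A.terminationTime i I = ∞ := by
  rw [terminationTime, iInf_eq_top]
  refine fun t => iInf_eq_top.2 fun ht => (h i t ?_).elim
  rw [← ht, A.wireless I t fun s _ j => h j s]

/-- An agent needs, after the first visit of the target, at least the time given by its distance
from the target. -/
theorem le_terminationTime {D : Set Plane} (A : SearchAlgorithm D) {I : D} {t : ℝ≥0}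
    (h : ∀ s < t, ∀ j, A.base j s ≠ I) (i : Fin 2) :
    ((t + nndist (A.base i t) I : ℝ≥0) : ℝ≥0∞) ≤ A.terminationTime i I := by
  refine le_iInf fun s => le_iInf fun hs => ENNReal.coe_le_coe.2 ?_
  have hts : t ≤ s := by
    by_contra! hlt
    refine h s hlt i ?_
    rw [← hs, A.wireless I s fun r hr => h r (hr.trans hlt)]
  have hd := (A.run_speed I i).dist_le_mul t s
  rw [hs, A.wireless I t h i, NNReal.dist_eq, abs_sub_comm,
    abs_of_nonneg (sub_nonneg.2 (NNReal.coe_le_coe.2 hts))] at hd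
  rw [← NNReal.coe_le_coe]
  push_cast at hd ⊢
  linarith

theorem exists_relObjective_le (A : SearchAlgorithm diskDomain) {f : ℝ × ℝ → ℝ}
    (hmono : MonotoneOn f (Set.Ici 0)) {n : ℕ} (hn : 1 ≤ n) {τ : ℝ} (hτ0 : 0 ≤ τ)
    (hτ : τ < 1 + Real.pi / n) {w : ℝ}
    (hw : ∀ I : diskDomain,
      costAt f (A.terminationTime 0 I) (A.terminationTime 1 I) ≤ (w : EReal)) :
    ∃ (ρ : Equiv.Perm (Fin n)) (b : Fin n → Fin 2) (d : Fin 2 × Fin n → Fin 2 × Fin n → ℝ),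
      IsRelMetric ρ b d ∧ relObjective f b d τ ≤ w := by
  have : Nonempty (Fin n) := ⟨⟨0, hn⟩⟩
  obtain ⟨P, hP1, hPdist, hPτ⟩ := A.exists_gon_unvisited hn hτ
  let I : Fin n → diskDomain := fun k => ⟨P k, by simp [diskDomain, hP1]⟩
  by_cases hvis : ∀ k, ∃ j t, A.base j t = P k
  · choose a T hT hfirst using fun k => A.exists_first_visit (hvis k)
    let ρ := Tuple.sort T
    let b : Fin n → Fin 2 := fun i => a (ρ i)
    let t : Fin n → ℝ := fun i => T (ρ i)
    -- Index `(j, i)` stands for the position of agent `j` when the `i`-th vertex in visiting order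
    -- is first visited. For `j = b i` this is the vertex itself.
    let d : Fin 2 × Fin n → Fin 2 × Fin n → ℝ := fun p q =>
      dist (A.base p.1 (T (ρ p.2))) (A.base q.1 (T (ρ q.2)))
    have hTmono : Monotone (T ∘ ρ) := Tuple.monotone_sort T
    have hd : ∀ p i, d p (b i, i) = dist (A.base p.1 (T (ρ p.2))) (P (ρ i)) := fun p i => by
      dsimp only [d, b]
      rw [hT]
    have hfeas : RelFeasible n ρ b τ (fun j i => t i + d (j, i) (b i, i)) t d :=
      { start := fun i => hPτ _ _ _ (hT (ρ i))
        mono := fun i i' hi => NNReal.coe_le_coe.2 (hTmono hi)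
        speed := fun i i' hi j => by
          have hle : T (ρ i) ≤ T (ρ i') :=
            hTmono (Fin.le_def.2 (by omega))
          have := (A.base_speed j).dist_le_mul (T (ρ i')) (T (ρ i))
          rwa [NNReal.coe_one, one_mul, NNReal.dist_eq,
            abs_of_nonneg (sub_nonneg.2 (NNReal.coe_le_coe.2 hle))] at this
        arrive := fun i j => le_rfl
        gon := fun i i' => by
          rw [hd, hT, hPdist]
        dist_nonneg := fun p q => dist_nonneg
        dist_self := fun p => dist_self _
        dist_symm := fun p q => dist_comm _ _
        dist_triangle := fun p q r => dist_triangle _ _ _ }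
    refine ⟨ρ, b, _, hfeas.isRelMetric_min, (hfeas.relObjective_min_le hmono hτ0).trans ?_⟩
    refine ciSup_le fun i => ?_
    have h := fun j => A.le_terminationTime (I := I (ρ i)) (hfirst (ρ i)) j
    have hcost := (le_costAt f (h 0) (h 1)).trans (hw (I (ρ i)))
    rw [hd, hd]
    exact_mod_cast hcost
  · push Not at hvis
    obtain ⟨k, hk⟩ := hvis
    -- With an unvisited vertex as target both termination times are infinite, so `f ≤ w` on the
    -- whole quadrant and any admissible metric works.
    obtain ⟨d, hd⟩ := exists_isRelMetric (Equiv.refl (Fin n)) fun _ => 0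
    refine ⟨_, _, d, hd, ciSup_le fun i => ?_⟩
    have hcost : ∀ x : ℝ × ℝ, 0 ≤ x → f x ≤ w := fun x hx => by
      have htop := A.terminationTime_eq_top (I := I k) hk
      have := (le_costAt f (x := ⟨x.1, hx.1⟩) (y := ⟨x.2, hx.2⟩) (le_top.trans_eq (htop 0).symm)
        (le_top.trans_eq (htop 1).symm)).trans (hw (I k))
      exact_mod_cast this
    exact hcost _ le_sup_right

end SearchAlgorithm

theorem mainTheorem4 (f : ℝ × ℝ → ℝ) (hmono : MonotoneOn f (Set.Ici 0))
    (hlsc : LowerSemicontinuousOn f (Set.Ici 0)) (hpos : 0 < f (1, 1))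
    (n : ℕ) (hn : 1 ≤ n) :
    (∀ (ρ : Equiv.Perm (Fin n)) (b : Fin n → Fin 2),
      IsLeast (relValues f n ρ b (1 + Real.pi / n)) (relValue f n ρ b (1 + Real.pi / n))) ∧
    ∀ A : SearchAlgorithm diskDomain,
      ((1 / f (1, 1) * ⨅ (ρ : Equiv.Perm (Fin n)) (b : Fin n → Fin 2),
          relValue f n ρ b (1 + Real.pi / n) : ℝ) : EReal) ≤ A.searchCost f := by
  have ht₀ : 0 < 1 + Real.pi / n := by positivity
  refine ⟨fun ρ b => isLeast_relValue hmono hlsc ρ b ht₀.le, fun A => ?_⟩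
  by_contra! hlt
  -- A real strictly between the cost and the bound leaves the room needed to move the start below
  -- `1 + π / n`.
  obtain ⟨r, hr, hrV⟩ := EReal.lt_iff_exists_real_btwn.1 hlt
  have hrV : f (1, 1) * r < ⨅ (ρ : Equiv.Perm (Fin n)) (b : Fin n → Fin 2),
      relValue f n ρ b (1 + Real.pi / n) := by
    have := EReal.coe_lt_coe_iff.1 hrV
    rwa [one_div_mul_eq_div, lt_div_iff₀' hpos] at this
  have hw : ∀ I : diskDomain, costAt f (A.terminationTime 0 I) (A.terminationTime 1 I) ≤
      ((f (1, 1) * r : ℝ) : EReal) := fun I => by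
    have hI : ‖(I : Plane)‖ = 1 := by simpa [diskDomain] using I.2
    have := (le_iSup (fun I : diskDomain =>
      costAt f (A.terminationTime 0 I) (A.terminationTime 1 I) /
        ((f (‖(I : Plane)‖, ‖(I : Plane)‖) : ℝ) : EReal)) I).trans hr.le
    rwa [hI, EReal.div_le_iff_le_mul (by exact_mod_cast hpos) (EReal.coe_ne_top _),
      ← EReal.coe_mul] at this
  have hev : ∀ᶠ s in nhds (1 + Real.pi / n), ∀ (ρ : Equiv.Perm (Fin n)) (b : Fin n → Fin 2) d,
      IsRelMetric ρ b d → f (1, 1) * r < relObjective f b d s := by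
    refine Filter.eventually_all.2 fun ρ => Filter.eventually_all.2 fun b => ?_
    refine eventually_lt_relObjective hmono hlsc ht₀.le (hrV.trans_le ?_)
    exact (ciInf_le (Set.finite_range _).bddBelow ρ).trans
      (ciInf_le (Set.finite_range _).bddBelow b)
  obtain ⟨τ, ⟨hτ, hτ0⟩, hτlt⟩ := ((hev.and (lt_mem_nhds ht₀)).filter_mono nhdsWithin_le_nhds
    |>.and (self_mem_nhdsWithin (s := Set.Iio (1 + Real.pi / n)))).exists
  obtain ⟨ρ, b, d, hd, hle⟩ := A.exists_relObjective_le hmono hn hτ0.le hτlt hw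
  exact (hτ ρ b d hd).not_ge hle
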